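/- Manifolds are smooth, finite-dimensional, Hausdorff and without boundary, and $U$ is moreover second countable. Let $\mathcal G\rightrightarrows M$ be a Lie groupoid with source $s$, target $t$, inversion $i$ and units $1_x$. Its Lie algebroid is the vector bundle $A\mathcal G=(\ker ds)|_M$, the pullback of $\ker ds$ along the unit map. For a compactly supported smooth section $\sigma\in\Gamma_c(A\mathcal G)$ let $\overrightarrow{\sigma}(g)=dR_g(\sigma(t(g)))$ and $\overleftarrow{\sigma}(g)=dL_g(di(\sigma(s(g))))$ be the corresponding right- and left-invariant vector fields on $\mathcal G$, where $R_g(h)=hg$ and $L_g(h)=gh$. Let $\Gamma_c^{RI}T\mathcal G$ (respectively $\Gamma_c^{LI}T\mathcal G$) be the set of all finite sums $\sum_j f_j\overrightarrow{\sigma_j}$ (respectively $\sum_j f_j\overleftarrow{\sigma_j}$) with $f_j\in C_c^\infty(\mathcal G)$ and $\sigma_j\in\Gamma_c(A\mathcal G)$. The orbit foliation is the module $\mathcal F^{\mathcal G}=dt(\Gamma_c(A\mathcal G))$ of vector fields on $M$. For a smooth map $f:U\to N$ and a set $\mathcal D$ of vector fields on $N$, let $f^*\mathcal D$ be the set of finite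 sums $\sum_j g_j\,(X_j\circ f)$ with $g_j\in C_c^\infty(U)$ and $X_j\in\mathcal D$, and let $f^{-1}(\mathcal D)$ be the set of smooth compactly supported vector fields $X$ on $U$ with $df\circ X\in f^*\mathcal D$. Let $\Gamma_c(U;\ker df)$ be the set of smooth compactly supported vector fields $X$ on $U$ with $df\circ X=0$. Let $s_U,t_U:U\to M$ be such that $(U,t_U,s_U)$ is a bi-submersion of $\mathcal F^{\mathcal G}$, i.e. $s_U$ and $t_U$ are submersions and $$s_U^{-1}(\mathcal F^{\mathcal G})=t_U^{-1}(\mathcal F^{\mathcal G})=\Gamma_c(U;\ker ds_U)+\Gamma_c(U;\ker dt_U).$$ Let $\psi:U\to\mathcal G$ be a smooth submersion with $s_U=s\circ\psi$ and $t_U=t\circ\psi$. Then $(U,\psi,\mathcal G)$ is a bi-submersion of $A\mathcal G$, that is: (a) $\psi$ is smooth; (b) $s\circ\psi$ and $t\circ\psi$ are submersions; (c) for every $\sigma\in\Gamma_c(A\mathcal G)$ there are smooth vector fields $Z$ and $W$ on $U$ such that $Z$ is $\psi$-related to $\overrightarrow{\sigma}$ and $W$ is $\psi$-related to $\overleftarrow{\sigma}$;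 (d) $\psi^{-1}(\Gamma_c^{RI}T\mathcal G)=\Gamma_c(U;\ker d(s\circ\psi))$ and $\psi^{-1}(\Gamma_c^{LI}T\mathcal G)=\Gamma_c(U;\ker d(t\circ\psi))$. -/

import Mathlib

open scoped Manifold ContDiff

namespace FoliationBisub

section VectorFields

variable (E : Type*) [NormedAddCommGroup E] [NormedSpace ℝ E]
  (F : Type*) [NormedAddCommGroup F] [NormedSpace ℝ F]
  {U : Type*} [TopologicalSpace U] [ChartedSpace E U] [IsManifold 𝓘(ℝ, E) ∞ U]
  {M : Type*} [TopologicalSpace M] [ChartedSpace F M] [IsManifold 𝓘(ℝ, F) ∞ M]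

/-- A (not necessarily smooth) vector field on `U`. -/
abbrev VField (U : Type*) [TopologicalSpace U] [ChartedSpace E U] : Type _ :=
  ∀ u : U, TangentSpace 𝓘(ℝ, E) u

/-- The smooth vector fields on `U`. -/
def smoothFields (U : Type*) [TopologicalSpace U] [ChartedSpace E U] [IsManifold 𝓘(ℝ, E) ∞ U] :
    Set (VField E U) :=
  {X | ContMDiff 𝓘(ℝ, E) (𝓘(ℝ, E)).tangent ∞ (fun u => (⟨u, X u⟩ : TangentBundle 𝓘(ℝ, E) U))}

/-- The smooth compactly supported vector fields on `U`. -/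
def compactFields (U : Type*) [TopologicalSpace U] [ChartedSpace E U]
    [IsManifold 𝓘(ℝ, E) ∞ U] : Set (VField E U) :=
  {X | X ∈ smoothFields E U ∧ IsCompact (closure {u | X u ≠ 0})}

/-- The smooth compactly supported real functions on `U`. -/
def compactFunctions (U : Type*) [TopologicalSpace U] [ChartedSpace E U] : Set (U → ℝ) :=
  {g | ContMDiff 𝓘(ℝ, E) 𝓘(ℝ, ℝ) ∞ g ∧ HasCompactSupport g}

/-- `Γ_c(U; ker df)`: smooth compactly supported vector fields on `U` annihilated by `df`. -/
def verticalFields (f : U → M) : Set (VField E U) :=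
  {X | X ∈ compactFields E U ∧ ∀ u, mfderiv 𝓘(ℝ, E) 𝓘(ℝ, F) f u (X u) = 0}

/-- `f^* D`: the finite sums `∑ gᵢ • (Xᵢ ∘ f)` with `gᵢ` smooth compactly supported functions on
`U` and `Xᵢ ∈ D`; these are sections of `f^* TM`. -/
def pullbackSections (f : U → M) (D : Set (VField F M)) :
    Set (∀ u : U, TangentSpace 𝓘(ℝ, F) (f u)) :=
  {ξ | ∃ (k : ℕ) (g : Fin k → U → ℝ) (X : Fin k → VField F M),
    (∀ i, g i ∈ compactFunctions E U) ∧ (∀ i, X i ∈ D) ∧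
      ∀ u, ξ u = ∑ i, g i u • X i (f u)}

/-- `f⁻¹(D)`: the smooth compactly supported vector fields `X` on `U` with `df ∘ X ∈ f^* D`. -/
def pullbackFields (f : U → M) (D : Set (VField F M)) : Set (VField E U) :=
  {X | X ∈ compactFields E U ∧
    (fun u => mfderiv 𝓘(ℝ, E) 𝓘(ℝ, F) f u (X u)) ∈ pullbackSections E F f D}

/-- `(U, t, s)` is a bi-submersion of the module `D` of vector fields on `M`: the maps `s` and `t`
are submersions and `s⁻¹(D) = t⁻¹(D) = Γ_c(U; ker ds) + Γ_c(U; ker dt)`. -/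
structure IsBisubmersion (D : Set (VField F M)) (t s : U → M) : Prop where
  submersion_s : Manifold.IsSubmersion 𝓘(ℝ, E) 𝓘(ℝ, F) ∞ s
  submersion_t : Manifold.IsSubmersion 𝓘(ℝ, E) 𝓘(ℝ, F) ∞ t
  pullback_s : pullbackFields E F s D =
    {Z | ∃ X ∈ verticalFields E F s, ∃ Y ∈ verticalFields E F t, ∀ u, Z u = X u + Y u}
  pullback_t : pullbackFields E F t D =
    {Z | ∃ X ∈ verticalFields E F s, ∃ Y ∈ verticalFields E F t, ∀ u, Z u = X u + Y u}

/-- The vector fields `X` on `U` and `Y` on `M` are `f`-related. -/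
def Related (f : U → M) (X : VField E U) (Y : VField F M) : Prop :=
  ∀ u, mfderiv 𝓘(ℝ, E) 𝓘(ℝ, F) f u (X u) = Y (f u)

end VectorFields

/-- A Lie groupoid `G ⇉ M` with source `s`, target `t`, units `one`, inversion `inv` and product
`mul g h`, meaningful when `s g = t h`. The values of `mul` at pairs that are not composable are
irrelevant: all the laws, and the smoothness of `mul`, concern the embedded submanifold of
composable pairs only. -/
structure LieGroupoid (EG : Type*) [NormedAddCommGroup EG] [NormedSpace ℝ EG]
    (EM : Type*) [NormedAddCommGroup EM] [NormedSpace ℝ EM]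
    (G : Type*) [TopologicalSpace G] [ChartedSpace EG G] [IsManifold 𝓘(ℝ, EG) ∞ G]
    (M : Type*) [TopologicalSpace M] [ChartedSpace EM M] [IsManifold 𝓘(ℝ, EM) ∞ M] where
  s : G → M
  t : G → M
  one : M → G
  inv : G → G
  mul : G → G → G
  s_one : ∀ x, s (one x) = x
  t_one : ∀ x, t (one x) = x
  s_inv : ∀ g, s (inv g) = t g
  t_inv : ∀ g, t (inv g) = s g
  s_mul : ∀ g h, s g = t h → s (mul g h) = s h
  t_mul : ∀ g h, s g = t h → t (mul g h) = t g
  mul_assoc : ∀ g h k, s g = t h → s h = t k → mul (mul g h) k = mul g (mul h k)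
  one_mul : ∀ g, mul (one (t g)) g = g
  mul_one : ∀ g, mul g (one (s g)) = g
  inv_mul : ∀ g, mul (inv g) g = one (s g)
  mul_inv : ∀ g, mul g (inv g) = one (t g)
  submersion_s : Manifold.IsSubmersion 𝓘(ℝ, EG) 𝓘(ℝ, EM) ∞ s
  submersion_t : Manifold.IsSubmersion 𝓘(ℝ, EG) 𝓘(ℝ, EM) ∞ t
  smooth_one : ContMDiff 𝓘(ℝ, EM) 𝓘(ℝ, EG) ∞ one
  smooth_inv : ContMDiff 𝓘(ℝ, EG) 𝓘(ℝ, EG) ∞ inv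
  smooth_mul : ContMDiffOn (𝓘(ℝ, EG).prod 𝓘(ℝ, EG)) 𝓘(ℝ, EG) ∞
    (fun p : G × G => mul p.1 p.2) {p | s p.1 = t p.2}

namespace LieGroupoid

variable {EG : Type*} [NormedAddCommGroup EG] [NormedSpace ℝ EG]
  {EM : Type*} [NormedAddCommGroup EM] [NormedSpace ℝ EM]
  {G : Type*} [TopologicalSpace G] [ChartedSpace EG G] [IsManifold 𝓘(ℝ, EG) ∞ G]
  {M : Type*} [TopologicalSpace M] [ChartedSpace EM M] [IsManifold 𝓘(ℝ, EM) ∞ M]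
  (𝒢 : LieGroupoid EG EM G M)

/-- `Γ_c(AG)`: the smooth compactly supported sections of the Lie algebroid `AG = (ker ds)|_M`,
the pullback of `ker ds` along the unit map. -/
def algebroidSections : Set (∀ x : M, TangentSpace 𝓘(ℝ, EG) (𝒢.one x)) :=
  {σ | ContMDiff 𝓘(ℝ, EM) (𝓘(ℝ, EG)).tangent ∞
        (fun x => (⟨𝒢.one x, σ x⟩ : TangentBundle 𝓘(ℝ, EG) G)) ∧
      (∀ x, mfderiv 𝓘(ℝ, EG) 𝓘(ℝ, EM) 𝒢.s (𝒢.one x) (σ x) = 0) ∧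
      IsCompact (closure {x | σ x ≠ 0})}

/-- The right-invariant vector field of a section `σ` of `AG`: its value at `g` is `dR_g (σ (t g))`
where `R_g h = h g` is right translation `s⁻¹(t g) → G`, differentiated at the unit `1_{t g}`.
The vector `σ (t g)` is tangent to the submanifold `s⁻¹(t g)`, so the value of the derivative of
`R_g` within this submanifold is determined. Since `1_{t g} g = g`, it is a tangent vector at
`g`. -/
noncomputable def rightField (σ : ∀ x : M, TangentSpace 𝓘(ℝ, EG) (𝒢.one x)) : VField EG G :=
  fun g => mfderivWithin 𝓘(ℝ, EG) 𝓘(ℝ, EG) (fun h => 𝒢.mul h g) {h | 𝒢.s h = 𝒢.t g}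
    (𝒢.one (𝒢.t g)) (σ (𝒢.t g))

/-- The left-invariant vector field of a section `σ` of `AG`: its value at `g` is
`dL_g (di (σ (s g)))` where `i` is the inversion, which carries `ker ds` to `ker dt`, and
`L_g h = g h` is left translation `t⁻¹(s g) → G`, differentiated at the unit `1_{s g}`. -/
noncomputable def leftField (σ : ∀ x : M, TangentSpace 𝓘(ℝ, EG) (𝒢.one x)) : VField EG G :=
  fun g => mfderivWithin 𝓘(ℝ, EG) 𝓘(ℝ, EG) (fun h => 𝒢.mul g h) {h | 𝒢.t h = 𝒢.s g}
    (𝒢.one (𝒢.s g))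
    (mfderiv 𝓘(ℝ, EG) 𝓘(ℝ, EG) 𝒢.inv (𝒢.one (𝒢.s g)) (σ (𝒢.s g)))

/-- The module spanned by the right-invariant vector fields of compactly supported sections of
`AG`, over the smooth compactly supported functions on `G`. -/
def rightModule : Set (VField EG G) :=
  {Y | ∃ (k : ℕ) (f : Fin k → G → ℝ) (σ : Fin k → ∀ x : M, TangentSpace 𝓘(ℝ, EG) (𝒢.one x)),
    (∀ i, f i ∈ compactFunctions EG G) ∧ (∀ i, σ i ∈ 𝒢.algebroidSections) ∧
      ∀ g, Y g = ∑ i, f i g • 𝒢.rightField (σ i) g}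

/-- The module spanned by the left-invariant vector fields of compactly supported sections of
`AG`, over the smooth compactly supported functions on `G`. -/
def leftModule : Set (VField EG G) :=
  {Y | ∃ (k : ℕ) (f : Fin k → G → ℝ) (σ : Fin k → ∀ x : M, TangentSpace 𝓘(ℝ, EG) (𝒢.one x)),
    (∀ i, f i ∈ compactFunctions EG G) ∧ (∀ i, σ i ∈ 𝒢.algebroidSections) ∧
      ∀ g, Y g = ∑ i, f i g • 𝒢.leftField (σ i) g}

/-- The orbit foliation of `G ⇉ M`: the module `dt(Γ_c(AG))` of vector fields on `M`. The vector
`dt (σ x)` is tangent at `t (1_x) = x`. -/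
def orbitFoliation : Set (VField EM M) :=
  {X | ∃ σ ∈ 𝒢.algebroidSections,
    ∀ x, X x = mfderiv 𝓘(ℝ, EG) 𝓘(ℝ, EM) 𝒢.t (𝒢.one x) (σ x)}

/-- `(U, ψ, G)` is a bi-submersion of the Lie algebroid `AG`. -/
structure IsAlgebroidBisubmersion (EU : Type*) [NormedAddCommGroup EU] [NormedSpace ℝ EU]
    {U : Type*} [TopologicalSpace U] [ChartedSpace EU U] [IsManifold 𝓘(ℝ, EU) ∞ U]
    (ψ : U → G) : Prop where
  smooth : ContMDiff 𝓘(ℝ, EU) 𝓘(ℝ, EG) ∞ ψ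
  submersion_s : Manifold.IsSubmersion 𝓘(ℝ, EU) 𝓘(ℝ, EM) ∞ (𝒢.s ∘ ψ)
  submersion_t : Manifold.IsSubmersion 𝓘(ℝ, EU) 𝓘(ℝ, EM) ∞ (𝒢.t ∘ ψ)
  lift_right : ∀ σ ∈ 𝒢.algebroidSections,
    ∃ Z ∈ smoothFields EU U, Related EU EG ψ Z (𝒢.rightField σ)
  lift_left : ∀ σ ∈ 𝒢.algebroidSections,
    ∃ W ∈ smoothFields EU U, Related EU EG ψ W (𝒢.leftField σ)
  pullback_right : pullbackFields EU EG ψ 𝒢.rightModule = verticalFields EU EM (𝒢.s ∘ ψ)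
  pullback_left : pullbackFields EU EG ψ 𝒢.leftModule = verticalFields EU EM (𝒢.t ∘ ψ)

end LieGroupoid

end FoliationBisub

open scoped Topology

set_option linter.unusedSectionVars false

/-! Smoothness of `ψ` and submersivity of `s ∘ ψ`, `t ∘ ψ` are immediate. For (c), lifts along a
submersion exist locally; at each point they form an affine, hence convex, set, so a partition of
unity glues them (`exists_related_of_isSubmersion`).

For (d), right translation preserves the source, so right-invariant fields are tangent to the
`s`-fibres; this gives one inclusion. Conversely, let `X` be killed by `d(s ∘ ψ)`. Then `dψ (X u)`
lies in `ker ds`, and right translation by `ψ(u)⁻¹` turns it into an algebroid vector at the unit of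
`t (ψ u)`. Expanding in local generators of the algebroid and translating back by `ψ u` writes `dψ ∘
X` locally through right-invariant fields (`exists_local_expansion`), and these expressions glue
(`mem_pullbackSections_of_local`). The left-invariant statements are the right-invariant ones for
the opposite groupoid (`leftModule_eq`).

The technical difficulty is that multiplication is smooth only on composable pairs. Smooth local
retractions onto fibres (`FiberRetraction`) turn derivatives along a source fibre into derivatives
of maps defined on open sets. -/

namespace FoliationBisub

/-! ### Derivatives of smooth families and retractions onto the fibres of a submersion. -/

section Fields

variable {E F E' : Type*} [NormedAddCommGroup E] [NormedSpace ℝ E]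
  [NormedAddCommGroup F] [NormedSpace ℝ F] [NormedAddCommGroup E'] [NormedSpace ℝ E']
  {P M N : Type*} [TopologicalSpace P] [ChartedSpace E P] [IsManifold 𝓘(ℝ, E) ∞ P]
  [TopologicalSpace M] [ChartedSpace F M] [IsManifold 𝓘(ℝ, F) ∞ M]
  [TopologicalSpace N] [ChartedSpace E' N] [IsManifold 𝓘(ℝ, E') ∞ N]

/-- The image of a smooth field along `g` under the fibre derivatives of a smooth family of maps
is smooth. -/
theorem contMDiffAt_mfderiv_apply {f : P → M → N} {g : P → M}
    {v : ∀ p, TangentSpace 𝓘(ℝ, F) (g p)} {p₀ : P}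
    (hf : ContMDiffAt (𝓘(ℝ, E).prod 𝓘(ℝ, F)) 𝓘(ℝ, E') ∞ (Function.uncurry f) (p₀, g p₀))
    (hv : ContMDiffAt 𝓘(ℝ, E) 𝓘(ℝ, F).tangent ∞
      (fun p => (⟨g p, v p⟩ : TangentBundle 𝓘(ℝ, F) M)) p₀) :
    ContMDiffAt 𝓘(ℝ, E) 𝓘(ℝ, E').tangent ∞
      (fun p => (⟨f p (g p), mfderiv 𝓘(ℝ, F) 𝓘(ℝ, E') (f p) (g p) (v p)⟩ :
        TangentBundle 𝓘(ℝ, E') N)) p₀ := by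
  have hg : ContMDiffAt 𝓘(ℝ, E) 𝓘(ℝ, F) ∞ g p₀ := (Bundle.contMDiffAt_totalSpace.1 hv).1
  have hfg : ContMDiffAt 𝓘(ℝ, E) 𝓘(ℝ, E') ∞ (fun p => f p (g p)) p₀ :=
    ContMDiffAt.comp (g := Function.uncurry f) (f := fun p => (p, g p)) p₀ hf
      (contMDiffAt_id.prodMk hg)
  exact ContMDiffAt.clm_apply_of_inCoordinates (E₁ := (TangentSpace 𝓘(ℝ, F) : M → Type _))
    (E₂ := (TangentSpace 𝓘(ℝ, E') : N → Type _)) (b₁ := g) (b₂ := fun p => f p (g p))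
    (ϕ := fun p => mfderiv 𝓘(ℝ, F) 𝓘(ℝ, E') (f p) (g p)) (v := v)
    (ContMDiffAt.mfderiv (m := ∞) f g hf hg le_rfl) hv hfg

/-- A tangent vector transported along an equality of base points. -/
theorem tangentBundle_mk_congr {x y : M} (h : x = y) (v : F) :
    (⟨x, v⟩ : TangentBundle 𝓘(ℝ, F) M) = ⟨y, v⟩ := by
  subst h; rfl

/-- A smooth local family of retractions onto the fibres of a map `f`: `ret y` maps a part of
`P` to `f ⁻¹ {y}` and fixes the points of this fibre. -/
structure FiberRetraction (f : P → M) (ret : M → P → P) (W : Set (M × P)) : Prop where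
  isOpen : IsOpen W
  smooth : ContMDiffOn (𝓘(ℝ, F).prod 𝓘(ℝ, E)) 𝓘(ℝ, E) ∞ (Function.uncurry ret) W
  map_ret : ∀ y u, (y, u) ∈ W → f (ret y u) = y
  ret_self : ∀ u, (f u, u) ∈ W → ret (f u) u = u

/-- In charts where `f` is a linear projection, replace the base coordinate of `u` by that of `y`
and keep the fibre coordinate. `W` is where the result stays in the chart. -/
theorem exists_fiberRetraction {f : P → M} {u₀ : P}
    (hf : Manifold.IsSubmersionAt 𝓘(ℝ, E) 𝓘(ℝ, F) ∞ f u₀) :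
    ∃ (ret : M → P → P) (W : Set (M × P)),
      FiberRetraction (E := E) (F := F) f ret W ∧ (f u₀, u₀) ∈ W := by
  obtain ⟨C, _, _, φ, χ, hu, hfu, hφ, hχ, hsub, e, he⟩ := hf
  simp only [OpenPartialHomeomorph.extend, mfld_simps] at he
  let A : M × P → E := fun q => e.symm (χ q.1, (e (φ q.2)).2)
  have hA : ContMDiffOn (𝓘(ℝ, F).prod 𝓘(ℝ, E)) 𝓘(ℝ, E) ∞ A (χ.source ×ˢ φ.source) := by
    have h1 : ContMDiffOn (𝓘(ℝ, F).prod 𝓘(ℝ, E)) 𝓘(ℝ, F) ∞ (fun q : M × P => χ q.1)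
        (χ.source ×ˢ φ.source) :=
      (contMDiffOn_of_mem_maximalAtlas hχ).comp contMDiffOn_fst fun q hq => hq.1
    have h2 : ContMDiffOn (𝓘(ℝ, F).prod 𝓘(ℝ, E)) 𝓘(ℝ, E) ∞ (fun q : M × P => φ q.2)
        (χ.source ×ˢ φ.source) :=
      (contMDiffOn_of_mem_maximalAtlas hφ).comp contMDiffOn_snd fun q hq => hq.2
    have h3 : ContDiff ℝ ∞ (fun z : F × E => e.symm (z.1, (e z.2).2)) := by fun_prop
    exact h3.contMDiff.comp_contMDiffOn (h1.prodMk_space h2)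
  have hself : ∀ u ∈ φ.source, A (f u, u) = φ u := by
    intro u hu
    have := he (φ.map_source hu)
    simp only [Function.comp_apply, φ.left_inv hu] at this
    simp only [A, this, Prod.mk.eta, ContinuousLinearEquiv.symm_apply_apply]
  refine ⟨fun y u => φ.symm (A (y, u)), (χ.source ×ˢ φ.source) ∩ A ⁻¹' φ.target, ⟨?_, ?_, ?_, ?_⟩,
    ⟨hfu, hu⟩, ?_⟩
  · exact hA.continuousOn.isOpen_inter_preimage (χ.open_source.prod φ.open_source) φ.open_target
  · exact (contMDiffOn_symm_of_mem_maximalAtlas hφ).comp (hA.mono Set.inter_subset_left)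
      fun q hq => hq.2
  · intro y u h
    have h1 := he h.2
    refine χ.injOn (hsub (φ.map_target h.2)) h.1.1 ?_
    simpa [A] using h1
  · intro u h
    rw [hself u h.1.2, φ.left_inv h.1.2]
  · change A (f u₀, u₀) ∈ φ.target
    rw [hself u₀ hu]
    exact φ.map_source hu

/-- The derivative of a map at a point, as a linear map between the model spaces. -/
noncomputable def modelDeriv (E F : Type*) [NormedAddCommGroup E] [NormedSpace ℝ E]
    [NormedAddCommGroup F] [NormedSpace ℝ F] {P M : Type*} [TopologicalSpace P] [ChartedSpace E P]
    [TopologicalSpace M] [ChartedSpace F M] (f : P → M) (u : P) : E →L[ℝ] F :=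
  mfderiv 𝓘(ℝ, E) 𝓘(ℝ, F) f u

theorem modelDeriv_comp {g : M → N} {f : P → M} {u : P}
    (hg : MDifferentiableAt 𝓘(ℝ, F) 𝓘(ℝ, E') g (f u))
    (hf : MDifferentiableAt 𝓘(ℝ, E) 𝓘(ℝ, F) f u) (v : E) :
    modelDeriv E E' (g ∘ f) u v = modelDeriv F E' g (f u) (modelDeriv E F f u v) := by
  unfold modelDeriv
  rw [mfderiv_comp u hg hf]
  rfl

theorem modelDeriv_congr {f g : P → M} {u : P} (h : f =ᶠ[𝓝 u] g) :
    modelDeriv E F f u = modelDeriv E F g u :=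
  h.mfderiv_eq

theorem modelDeriv_const (c : M) (u : P) (v : E) : modelDeriv E F (fun _ => c) u v = 0 := by
  unfold modelDeriv
  rw [mfderiv_const]
  rfl

theorem modelDeriv_id (u : P) (v : E) : modelDeriv E E (fun p => p) u v = v := by
  have : modelDeriv E E (id : P → P) u v = v := by
    unfold modelDeriv
    rw [mfderiv_id]
    rfl
  exact this

theorem modelDeriv_map_eq_zero {g : M → N} {f : P → M} {u : P} {c : N}
    (hg : MDifferentiableAt 𝓘(ℝ, F) 𝓘(ℝ, E') g (f u))
    (hf : MDifferentiableAt 𝓘(ℝ, E) 𝓘(ℝ, F) f u) (h : ∀ᶠ p in 𝓝 u, g (f p) = c) (v : E) :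
    modelDeriv F E' g (f u) (modelDeriv E F f u v) = 0 := by
  rw [← modelDeriv_comp hg hf, modelDeriv_congr (f := g ∘ f) (g := fun _ => c) h, modelDeriv_const]

namespace FiberRetraction

variable {f : P → M} {ret : M → P → P} {W : Set (M × P)}

theorem contMDiffAt (h : FiberRetraction (E := E) (F := F) f ret W) {q : M × P} (hq : q ∈ W) :
    ContMDiffAt (𝓘(ℝ, F).prod 𝓘(ℝ, E)) 𝓘(ℝ, E) ∞ (Function.uncurry ret) q :=
  h.smooth.contMDiffAt (h.isOpen.mem_nhds hq)

theorem contMDiffAt_right (h : FiberRetraction (E := E) (F := F) f ret W) {y : M} {u : P}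
    (hq : (y, u) ∈ W) : ContMDiffAt 𝓘(ℝ, E) 𝓘(ℝ, E) ∞ (ret y) u :=
  ContMDiffAt.comp (g := Function.uncurry ret) (f := fun u => (y, u)) u (h.contMDiffAt hq)
    (contMDiffAt_const.prodMk contMDiffAt_id)

theorem contMDiffAt_left (h : FiberRetraction (E := E) (F := F) f ret W) {y : M} {u : P}
    (hq : (y, u) ∈ W) : ContMDiffAt 𝓘(ℝ, F) 𝓘(ℝ, E) ∞ (fun y => ret y u) y :=
  ContMDiffAt.comp (g := Function.uncurry ret) (f := fun y => (y, u)) y (h.contMDiffAt hq)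
    (contMDiffAt_id.prodMk contMDiffAt_const)

theorem mem_nhds_right (h : FiberRetraction (E := E) (F := F) f ret W) {y : M} {u : P}
    (hq : (y, u) ∈ W) : ∀ᶠ u' in 𝓝 u, (y, u') ∈ W :=
  (Continuous.prodMk_right y).continuousAt.eventually (h.isOpen.mem_nhds hq)

theorem mem_nhds_left (h : FiberRetraction (E := E) (F := F) f ret W) {y : M} {u : P}
    (hq : (y, u) ∈ W) : ∀ᶠ y' in 𝓝 y, (y', u) ∈ W :=
  (Continuous.prodMk_left u).continuousAt.eventually (h.isOpen.mem_nhds hq)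

theorem modelDeriv_map (h : FiberRetraction (E := E) (F := F) f ret W)
    (hf : ContMDiff 𝓘(ℝ, E) 𝓘(ℝ, F) ∞ f) {y : M} {u : P} (hq : (y, u) ∈ W) (v : E) :
    modelDeriv E F f (ret y u) (modelDeriv E E (ret y) u v) = 0 :=
  modelDeriv_map_eq_zero (hf.mdifferentiableAt (by simp))
    ((h.contMDiffAt_right hq).mdifferentiableAt (by simp))
    ((h.mem_nhds_right hq).mono fun _ hu => h.map_ret _ _ hu) v

/-- The map `y ↦ ret y u` is a local section of `f` through `u`, so its derivative is a right
inverse of `df`. -/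
theorem modelDeriv_lift (h : FiberRetraction (E := E) (F := F) f ret W)
    (hf : ContMDiff 𝓘(ℝ, E) 𝓘(ℝ, F) ∞ f) {u : P} (hq : (f u, u) ∈ W) (w : F) :
    modelDeriv E F f u (modelDeriv F E (fun y => ret y u) (f u) w) = w := by
  have h1 := modelDeriv_comp (g := f) (f := fun y => ret y u) (u := f u)
    (hf.mdifferentiableAt (by simp)) ((h.contMDiffAt_left hq).mdifferentiableAt (by simp)) w
  rw [h.ret_self u hq] at h1
  rw [← h1, modelDeriv_congr (f := f ∘ fun y => ret y u) (g := fun y => y)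
    ((h.mem_nhds_left hq).mono fun y hy => h.map_ret _ _ hy), modelDeriv_id]

/-- Differentiate `ret (f u) u = u`: the partial derivative in the base variable is applied to `df v
= 0` and drops out. -/
theorem modelDeriv_self (h : FiberRetraction (E := E) (F := F) f ret W)
    (hf : ContMDiff 𝓘(ℝ, E) 𝓘(ℝ, F) ∞ f) {u : P} (hq : (f u, u) ∈ W) {v : E}
    (hv : modelDeriv E F f u v = 0) : modelDeriv E E (ret (f u)) u v = v := by
  have hret := (h.contMDiffAt hq).mdifferentiableAt (by simp)
  have hfu : MDifferentiableAt 𝓘(ℝ, E) 𝓘(ℝ, F) f u := hf.mdifferentiableAt (by simp)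
  have hpair := hfu.hasMFDerivAt.prodMk (hasMFDerivAt_id u)
  have h1 := (HasMFDerivAt.comp (g := Function.uncurry ret) (f := fun y => (f y, id y)) u
    hret.hasMFDerivAt hpair).mfderiv
  have hev : (Function.uncurry ret ∘ fun y => (f y, id y)) =ᶠ[𝓝 u] fun p => p := by
    have hc : ContinuousAt (fun p => (f p, p)) u := (hf.continuous.prodMk continuous_id).continuousAt
    exact (hc.eventually (h.isOpen.mem_nhds hq)).mono fun p hp => h.ret_self p hp
  have h2 := modelDeriv_id u v
  rw [← modelDeriv_congr hev, modelDeriv, h1] at h2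
  have h3 := mfderiv_prod_eq_add_apply (v := (modelDeriv E F f u v, v)) hret
  have h4 : modelDeriv F E (fun z => ret z u) (f u) (modelDeriv E F f u v) +
      modelDeriv E E (ret (f u)) u v = v := h3.symm.trans h2
  rwa [hv, map_zero, zero_add] at h4

end FiberRetraction

end Fields

end FoliationBisub

namespace FoliationBisub

/-! ### Right translation of vectors tangent to source fibres. -/

namespace LieGroupoid

variable {EG : Type*} [NormedAddCommGroup EG] [NormedSpace ℝ EG]
  {EM : Type*} [NormedAddCommGroup EM] [NormedSpace ℝ EM]
  {G : Type*} [TopologicalSpace G] [ChartedSpace EG G] [IsManifold 𝓘(ℝ, EG) ∞ G]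
  {M : Type*} [TopologicalSpace M] [ChartedSpace EM M] [IsManifold 𝓘(ℝ, EM) ∞ M]
  (𝒢 : LieGroupoid EG EM G M)
  {EP : Type*} [NormedAddCommGroup EP] [NormedSpace ℝ EP]
  {P : Type*} [TopologicalSpace P] [ChartedSpace EP P] [IsManifold 𝓘(ℝ, EP) ∞ P]

theorem contMDiff_s : ContMDiff 𝓘(ℝ, EG) 𝓘(ℝ, EM) ∞ 𝒢.s := 𝒢.submersion_s.contMDiff

theorem contMDiff_t : ContMDiff 𝓘(ℝ, EG) 𝓘(ℝ, EM) ∞ 𝒢.t := 𝒢.submersion_t.contMDiff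

theorem inv_inv (g : G) : 𝒢.inv (𝒢.inv g) = g := by
  have h1 : 𝒢.mul (𝒢.mul (𝒢.inv (𝒢.inv g)) (𝒢.inv g)) g =
      𝒢.mul (𝒢.inv (𝒢.inv g)) (𝒢.mul (𝒢.inv g) g) :=
    𝒢.mul_assoc _ _ _ (by rw [𝒢.s_inv]) (𝒢.s_inv g)
  have h2 := 𝒢.mul_one (𝒢.inv (𝒢.inv g))
  rw [𝒢.s_inv, 𝒢.t_inv] at h2
  rw [𝒢.inv_mul, 𝒢.inv_mul, 𝒢.s_inv, 𝒢.one_mul, h2] at h1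
  exact h1.symm

theorem inv_one (x : M) : 𝒢.inv (𝒢.one x) = 𝒢.one x := by
  have h1 := 𝒢.mul_inv (𝒢.one x)
  have h2 := 𝒢.one_mul (𝒢.inv (𝒢.one x))
  rw [𝒢.t_inv, 𝒢.s_one] at h2
  rw [h2, 𝒢.t_one] at h1
  exact h1

/-- The opposite groupoid. -/
def opposite : LieGroupoid EG EM G M where
  s := 𝒢.t
  t := 𝒢.s
  one := 𝒢.one
  inv := 𝒢.inv
  mul g h := 𝒢.mul h g
  s_one := 𝒢.t_one
  t_one := 𝒢.s_one
  s_inv := 𝒢.t_inv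
  t_inv := 𝒢.s_inv
  s_mul g h e := 𝒢.t_mul h g e.symm
  t_mul g h e := 𝒢.s_mul h g e.symm
  mul_assoc g h k e e' := (𝒢.mul_assoc k h g e'.symm e.symm).symm
  one_mul := 𝒢.mul_one
  mul_one := 𝒢.one_mul
  inv_mul := 𝒢.mul_inv
  mul_inv := 𝒢.inv_mul
  submersion_s := 𝒢.submersion_t
  submersion_t := 𝒢.submersion_s
  smooth_one := 𝒢.smooth_one
  smooth_inv := 𝒢.smooth_inv
  smooth_mul := 𝒢.smooth_mul.comp (t := {p | 𝒢.s p.1 = 𝒢.t p.2})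
    (f := fun p : G × G => (p.2, p.1)) (contMDiff_snd.prodMk contMDiff_fst).contMDiffOn
    fun _ hp => Eq.symm hp

variable {𝒢} in
theorem contMDiffAt_mul {E : Type*} [NormedAddCommGroup E] [NormedSpace ℝ E] {H : Type*}
    [TopologicalSpace H] {I : ModelWithCorners ℝ E H} {Q : Type*} [TopologicalSpace Q]
    [ChartedSpace H Q] {a b : Q → G} {q : Q} (ha : ContMDiffAt I 𝓘(ℝ, EG) ∞ a q)
    (hb : ContMDiffAt I 𝓘(ℝ, EG) ∞ b q) (h : ∀ᶠ p in 𝓝 q, 𝒢.s (a p) = 𝒢.t (b p)) :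
    ContMDiffAt I 𝓘(ℝ, EG) ∞ (fun p => 𝒢.mul (a p) (b p)) q := by
  have h1 : ContMDiffWithinAt I 𝓘(ℝ, EG) ∞ (fun p => 𝒢.mul (a p) (b p))
      {p | 𝒢.s (a p) = 𝒢.t (b p)} q :=
    ContMDiffWithinAt.comp (g := fun p : G × G => 𝒢.mul p.1 p.2) (f := fun p => (a p, b p))
      (t := {p | 𝒢.s p.1 = 𝒢.t p.2}) q (𝒢.smooth_mul _ h.self_of_nhds)
      (ha.prodMk hb).contMDiffWithinAt fun p hp => hp
  exact h1.contMDiffAt h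

/-- The derivative at `h` of the right translation `h' ↦ h' g` of the fibre `s⁻¹(t g)`. -/
noncomputable def rightDeriv (g h : G) : EG →L[ℝ] EG :=
  mfderivWithin 𝓘(ℝ, EG) 𝓘(ℝ, EG) (fun h' => 𝒢.mul h' g) {h' | 𝒢.s h' = 𝒢.t g} h

theorem rightField_eq (σ : ∀ x : M, TangentSpace 𝓘(ℝ, EG) (𝒢.one x)) (g : G) :
    𝒢.rightField σ g = 𝒢.rightDeriv g (𝒢.one (𝒢.t g)) (σ (𝒢.t g)) :=
  rfl

variable {𝒢} {ret : M → G → G} {W : Set (M × G)}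

theorem contMDiffAt_ret_mul (hret : FiberRetraction (E := EG) (F := EM) 𝒢.s ret W) {g h : G}
    (hW : (𝒢.t g, h) ∈ W) :
    ContMDiffAt 𝓘(ℝ, EG) 𝓘(ℝ, EG) ∞ (fun h' => 𝒢.mul (ret (𝒢.t g) h') g) h :=
  contMDiffAt_mul (hret.contMDiffAt_right hW) contMDiffAt_const
    ((hret.mem_nhds_right hW).mono fun _ hp => hret.map_ret _ _ hp)

/-- As a derivative within a fibre, `rightDeriv` is a choice of linear map on all of `EG`. The chain
rule forces its values on vectors coming from maps into the fibre, which are the only values needed.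
-/
theorem comp_rightDeriv {g h : G} (hgh : 𝒢.s h = 𝒢.t g) {a : P → G} {p : P}
    (ha : MDifferentiableAt 𝓘(ℝ, EP) 𝓘(ℝ, EG) a p) (hp : a p = h)
    (has : ∀ᶠ q in 𝓝 p, 𝒢.s (a q) = 𝒢.t g) (v : EP) :
    modelDeriv EP EG (fun q => 𝒢.mul (a q) g) p v =
      𝒢.rightDeriv g h (modelDeriv EP EG a p v) := by
  subst hp
  have h1 : ContMDiffWithinAt 𝓘(ℝ, EG) 𝓘(ℝ, EG) ∞ (fun h' => 𝒢.mul h' g)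
      {h' | 𝒢.s h' = 𝒢.t g} (a p) :=
    ContMDiffWithinAt.comp (g := fun p : G × G => 𝒢.mul p.1 p.2) (f := fun p => (p, g))
      (t := {p | 𝒢.s p.1 = 𝒢.t p.2}) (a p) (𝒢.smooth_mul _ hgh)
      (contMDiffWithinAt_id.prodMk contMDiffWithinAt_const) fun p hp => hp
  have h2 := (h1.mdifferentiableWithinAt (by simp)).hasMFDerivWithinAt
  have h3 := HasMFDerivWithinAt.comp (s := {q | 𝒢.s (a q) = 𝒢.t g}) p h2
    ha.hasMFDerivAt.hasMFDerivWithinAt fun q hq => hq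
  have h4 := (h3.hasMFDerivAt has).mfderiv
  exact DFunLike.congr_fun h4 v

/-- Apply `comp_rightDeriv` to the retraction, whose derivative fixes `v`. The right side is an
ordinary derivative, so it can be differentiated and composed freely. -/
theorem rightDeriv_eq (hret : FiberRetraction (E := EG) (F := EM) 𝒢.s ret W) {g h : G}
    (hgh : 𝒢.s h = 𝒢.t g) (hW : (𝒢.t g, h) ∈ W) {v : EG} (hv : modelDeriv EG EM 𝒢.s h v = 0) :
    𝒢.rightDeriv g h v = modelDeriv EG EG (fun h' => 𝒢.mul (ret (𝒢.t g) h') g) h v := by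
  rw [comp_rightDeriv hgh ((hret.contMDiffAt_right hW).mdifferentiableAt (by simp))
    (hgh ▸ hret.ret_self h (hgh ▸ hW))
    ((hret.mem_nhds_right hW).mono fun _ hp => hret.map_ret _ _ hp)]
  rw [← hgh] at hW ⊢
  rw [hret.modelDeriv_self 𝒢.contMDiff_s hW hv]

variable (𝒢) in
theorem exists_retraction_s (h : G) : ∃ (ret : M → G → G) (W : Set (M × G)),
    FiberRetraction (E := EG) (F := EM) 𝒢.s ret W ∧ (𝒢.s h, h) ∈ W :=
  exists_fiberRetraction (𝒢.submersion_s.isSubmersionAt h)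

theorem modelDeriv_s_rightDeriv {g h : G} (hgh : 𝒢.s h = 𝒢.t g) {v : EG}
    (hv : modelDeriv EG EM 𝒢.s h v = 0) :
    modelDeriv EG EM 𝒢.s (𝒢.mul h g) (𝒢.rightDeriv g h v) = 0 := by
  obtain ⟨ret, W, hret, hW⟩ := 𝒢.exists_retraction_s h
  have hself := hret.ret_self h hW
  rw [hgh] at hW hself
  rw [rightDeriv_eq hret hgh hW hv]
  have := modelDeriv_map_eq_zero (u := h) (f := fun h' => 𝒢.mul (ret (𝒢.t g) h') g) (g := 𝒢.s)
    (c := 𝒢.s g) (𝒢.contMDiff_s.mdifferentiableAt (by simp))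
    ((contMDiffAt_ret_mul hret hW).mdifferentiableAt (by simp))
    ((hret.mem_nhds_right hW).mono fun _ hp => 𝒢.s_mul _ _ (hret.map_ret _ _ hp)) v
  rwa [hself] at this

/-- Associativity, differentiated in the left factor. -/
theorem rightDeriv_mul {g h k : G} (hgh : 𝒢.s h = 𝒢.t g) (hgk : 𝒢.s g = 𝒢.t k) {v : EG}
    (hv : modelDeriv EG EM 𝒢.s h v = 0) :
    𝒢.rightDeriv k (𝒢.mul h g) (𝒢.rightDeriv g h v) = 𝒢.rightDeriv (𝒢.mul g k) h v := by
  obtain ⟨ret, W, hret, hW⟩ := 𝒢.exists_retraction_s h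
  have hself := hret.ret_self h hW
  rw [hgh] at hW hself
  have htgk := 𝒢.t_mul g k hgk
  have hev := (hret.mem_nhds_right hW).mono fun _ hp => hret.map_ret _ _ hp
  rw [rightDeriv_eq hret hgh hW hv,
    rightDeriv_eq hret (hgh.trans htgk.symm) (htgk.symm ▸ hW) hv, htgk,
    ← comp_rightDeriv (𝒢.s_mul h g hgh ▸ hgk)
      ((contMDiffAt_ret_mul hret hW).mdifferentiableAt (by simp)) (by rw [hself])
      (hev.mono fun q hq => (𝒢.s_mul _ _ hq).trans hgk)]
  refine DFunLike.congr_fun (modelDeriv_congr (hev.mono fun q hq => ?_)) v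
  exact 𝒢.mul_assoc _ _ _ hq hgk

theorem rightDeriv_one {h : G} {v : EG} (hv : modelDeriv EG EM 𝒢.s h v = 0) :
    𝒢.rightDeriv (𝒢.one (𝒢.s h)) h v = v := by
  obtain ⟨ret, W, hret, hW⟩ := 𝒢.exists_retraction_s h
  have ht := 𝒢.t_one (𝒢.s h)
  rw [rightDeriv_eq hret ht.symm (ht.symm ▸ hW) hv, ht]
  have hev : (fun h' => 𝒢.mul (ret (𝒢.s h) h') (𝒢.one (𝒢.s h))) =ᶠ[𝓝 h] ret (𝒢.s h) := by
    refine (hret.mem_nhds_right hW).mono fun q hq => ?_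
    have := 𝒢.mul_one (ret (𝒢.s h) q)
    rwa [hret.map_ret _ _ hq] at this
  rw [modelDeriv_congr hev, hret.modelDeriv_self 𝒢.contMDiff_s hW hv]

/-- A vector tangent to a source fibre is recovered from its right translate to the unit. -/
theorem rightDeriv_rightDeriv_inv {g : G} {v : EG} (hv : modelDeriv EG EM 𝒢.s g v = 0) :
    𝒢.rightDeriv g (𝒢.one (𝒢.t g)) (𝒢.rightDeriv (𝒢.inv g) g v) = v := by
  have := rightDeriv_mul (𝒢.t_inv g).symm (𝒢.s_inv g) hv
  rwa [𝒢.mul_inv, 𝒢.inv_mul, rightDeriv_one hv] at this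

/-- By `rightDeriv_eq` the translate is a fibre derivative of the family `(p, h') ↦ ret (t (g p)) h'
· g p`, which is smooth near `(p₀, h p₀)`. -/
theorem contMDiffAt_rightDeriv {g h : P → G} {p₀ : P} (hg : ContMDiffAt 𝓘(ℝ, EP) 𝓘(ℝ, EG) ∞ g p₀)
    {ξ : ∀ p, TangentSpace 𝓘(ℝ, EG) (h p)}
    (hξ : ContMDiffAt 𝓘(ℝ, EP) 𝓘(ℝ, EG).tangent ∞
      (fun p => (⟨h p, ξ p⟩ : TangentBundle 𝓘(ℝ, EG) G)) p₀)
    (hgh : ∀ p, 𝒢.s (h p) = 𝒢.t (g p)) (hker : ∀ p, modelDeriv EG EM 𝒢.s (h p) (ξ p) = 0) :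
    ContMDiffAt 𝓘(ℝ, EP) 𝓘(ℝ, EG).tangent ∞
      (fun p => (⟨𝒢.mul (h p) (g p), 𝒢.rightDeriv (g p) (h p) (ξ p)⟩ :
        TangentBundle 𝓘(ℝ, EG) G)) p₀ := by
  obtain ⟨ret, W, hret, hW⟩ := 𝒢.exists_retraction_s (h p₀)
  have hh : ContMDiffAt 𝓘(ℝ, EP) 𝓘(ℝ, EG) ∞ h p₀ := (Bundle.contMDiffAt_totalSpace.1 hξ).1
  have htg : ContMDiffAt 𝓘(ℝ, EP) 𝓘(ℝ, EM) ∞ (fun p => 𝒢.t (g p)) p₀ :=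
    𝒢.contMDiff_t.contMDiffAt.comp p₀ hg
  rw [hgh] at hW
  have hA : ContMDiffAt (𝓘(ℝ, EP).prod 𝓘(ℝ, EG)) (𝓘(ℝ, EM).prod 𝓘(ℝ, EG)) ∞
      (fun q : P × G => (𝒢.t (g q.1), q.2)) (p₀, h p₀) :=
    (ContMDiffAt.comp (g := fun p => 𝒢.t (g p)) (f := Prod.fst) (p₀, h p₀) htg
      contMDiffAt_fst).prodMk contMDiffAt_snd
  have hevA := hA.continuousAt.eventually (hret.isOpen.mem_nhds hW)
  have hmul : ContMDiffAt (𝓘(ℝ, EP).prod 𝓘(ℝ, EG)) 𝓘(ℝ, EG) ∞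
      (Function.uncurry fun p h' => 𝒢.mul (ret (𝒢.t (g p)) h') (g p)) (p₀, h p₀) :=
    contMDiffAt_mul
      (ContMDiffAt.comp (g := Function.uncurry ret) (f := fun q : P × G => (𝒢.t (g q.1), q.2))
        (p₀, h p₀) (hret.contMDiffAt hW) hA)
      (ContMDiffAt.comp (g := g) (f := Prod.fst) (p₀, h p₀) hg contMDiffAt_fst)
      (hevA.mono fun q hq => hret.map_ret _ _ hq)
  refine (contMDiffAt_mfderiv_apply hmul hξ).congr_of_eventuallyEq ?_
  have hev := (htg.continuousAt.prodMk hh.continuousAt).eventually (hret.isOpen.mem_nhds hW)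
  refine hev.mono fun p hp => ?_
  have hself := hret.ret_self (h p) ((hgh p).symm ▸ hp)
  rw [hgh] at hself
  dsimp only
  rw [rightDeriv_eq hret (hgh p) hp (hker p)]
  exact (tangentBundle_mk_congr (F := EG) (by rw [hself]) _).symm

theorem contMDiff_rightField {σ : ∀ x : M, TangentSpace 𝓘(ℝ, EG) (𝒢.one x)}
    (hσ : σ ∈ 𝒢.algebroidSections) : 𝒢.rightField σ ∈ smoothFields EG G := by
  intro g₀
  have h1 := contMDiffAt_rightDeriv (𝒢 := 𝒢) (p₀ := g₀) (g := id) (h := fun g => 𝒢.one (𝒢.t g))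
    (ξ := fun g => σ (𝒢.t g)) contMDiffAt_id (hσ.1.comp 𝒢.contMDiff_t).contMDiffAt
    (fun g => 𝒢.s_one _) (fun g => hσ.2.1 _)
  convert h1 using 1
  funext g
  exact (tangentBundle_mk_congr (F := EG) (𝒢.one_mul g) _).symm

theorem modelDeriv_s_rightField {σ : ∀ x : M, TangentSpace 𝓘(ℝ, EG) (𝒢.one x)}
    (hσ : σ ∈ 𝒢.algebroidSections) (g : G) :
    modelDeriv EG EM 𝒢.s g (𝒢.rightField σ g) = 0 := by
  have := modelDeriv_s_rightDeriv (𝒢.s_one (𝒢.t g)) (hσ.2.1 (𝒢.t g))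
  rwa [𝒢.one_mul] at this

end LieGroupoid

end FoliationBisub

namespace FoliationBisub

/-! ### Cut-offs and local generators of the Lie algebroid. -/

section Bump

variable {F : Type*} [NormedAddCommGroup F] [NormedSpace ℝ F] [FiniteDimensional ℝ F]
  {M : Type*} [TopologicalSpace M] [T2Space M] [ChartedSpace F M] [IsManifold 𝓘(ℝ, F) ∞ M]

theorem smul_mem_smoothFields {β : M → ℝ} {V : VField F M} {O : Set M} (hO : IsOpen O)
    (hβ : ContMDiff 𝓘(ℝ, F) 𝓘(ℝ, ℝ) ∞ β) (hβO : tsupport β ⊆ O)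
    (hV : ContMDiffOn 𝓘(ℝ, F) 𝓘(ℝ, F).tangent ∞
      (fun x => (⟨x, V x⟩ : TangentBundle 𝓘(ℝ, F) M)) O) :
    (fun x => β x • V x) ∈ smoothFields F M := by
  intro x
  by_cases hx : x ∈ tsupport β
  · exact ContMDiffAt.smul_section (V := (TangentSpace 𝓘(ℝ, F) : M → Type _)) hβ.contMDiffAt
      (hV.contMDiffAt (hO.mem_nhds (hβO hx)))
  · refine ContMDiffAt.congr_of_eventuallyEq
      (Bundle.contMDiff_zeroSection ℝ (TangentSpace 𝓘(ℝ, F) : M → Type _)).contMDiffAt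
      ((notMem_tsupport_iff_eventuallyEq.1 hx).mono fun y hy => ?_)
    simp [hy, Bundle.zeroSection]

end Bump

namespace LieGroupoid

variable {EG : Type*} [NormedAddCommGroup EG] [NormedSpace ℝ EG] [FiniteDimensional ℝ EG]
  {EM : Type*} [NormedAddCommGroup EM] [NormedSpace ℝ EM]
  {G : Type*} [TopologicalSpace G] [T2Space G] [ChartedSpace EG G] [IsManifold 𝓘(ℝ, EG) ∞ G]
  {M : Type*} [TopologicalSpace M] [T2Space M] [ChartedSpace EM M] [IsManifold 𝓘(ℝ, EM) ∞ M]
  (𝒢 : LieGroupoid EG EM G M)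

/-- Around each point, finitely many compactly supported sections generate the Lie algebroid, with
coefficients depending smoothly on the tangent vector. -/
theorem exists_local_generators (x₀ : M) :
    ∃ (n : ℕ) (σ : Fin n → ∀ x : M, TangentSpace 𝓘(ℝ, EG) (𝒢.one x))
      (c : Fin n → TangentBundle 𝓘(ℝ, EG) G → ℝ) (O : Set M),
      IsOpen O ∧ x₀ ∈ O ∧ (∀ i, σ i ∈ 𝒢.algebroidSections) ∧
      (∀ i, ∀ z : TangentBundle 𝓘(ℝ, EG) G, ∀ x ∈ O, z.proj = 𝒢.one x →
        ContMDiffAt 𝓘(ℝ, EG).tangent 𝓘(ℝ, ℝ) ∞ (c i) z) ∧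
      (∀ i, ∀ x ∈ O, c i ⟨𝒢.one x, 0⟩ = 0) ∧
      ∀ x ∈ O, ∀ v : TangentSpace 𝓘(ℝ, EG) (𝒢.one x), modelDeriv EG EM 𝒢.s (𝒢.one x) v = 0 →
        v = ∑ i, c i ⟨𝒢.one x, v⟩ • σ i x := by
  obtain ⟨ret, W, hret, hW⟩ := 𝒢.exists_retraction_s (𝒢.one x₀)
  let b := Module.finBasis ℝ EG
  let e := trivializationAt EG (TangentSpace 𝓘(ℝ, EG) : G → Type _) (𝒢.one x₀)
  let Ω : Set G := e.baseSet ∩ {g | (𝒢.s g, g) ∈ W}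
  have hΩ : IsOpen Ω := e.open_baseSet.inter
    (hret.isOpen.preimage (𝒢.contMDiff_s.continuous.prodMk continuous_id))
  have hx₀Ω : 𝒢.one x₀ ∈ Ω := ⟨FiberBundle.mem_baseSet_trivializationAt' _, hW⟩
  obtain ⟨β, -, hβΩ⟩ := (SmoothBumpFunction.nhds_basis_tsupport (I := 𝓘(ℝ, EG))
    (𝒢.one x₀)).mem_iff.1 (hΩ.mem_nhds hx₀Ω)
  have hone : Continuous 𝒢.one := 𝒢.smooth_one.continuous
  have hΩW : ∀ x, 𝒢.one x ∈ Ω → (x, 𝒢.one x) ∈ W := fun x hx => by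
    have : (𝒢.s (𝒢.one x), 𝒢.one x) ∈ W := hx.2
    rwa [𝒢.s_one] at this
  have hself : ∀ x, 𝒢.one x ∈ Ω → ret x (𝒢.one x) = 𝒢.one x := fun x hx => by
    have := hret.ret_self _ hx.2
    rwa [𝒢.s_one] at this
  -- A full local frame of `TG`, cut off by `β`, is projected to `ker ds` along the units by the
  -- derivative of `ret x`. The resulting `σ` generate but need not be independent, so no frame of
  -- `ker ds` is required.
  let V : Fin _ → VField EG G := fun j g => β g • e.localFrame b j g
  have hV : ∀ j, V j ∈ smoothFields EG G := fun j =>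
    smul_mem_smoothFields hΩ β.contMDiff hβΩ
      ((e.contMDiffOn_localFrame_baseSet ∞ b j).mono Set.inter_subset_left)
  let σ : Fin _ → ∀ x : M, TangentSpace 𝓘(ℝ, EG) (𝒢.one x) := fun j x =>
    modelDeriv EG EG (ret x) (𝒢.one x) (V j (𝒢.one x))
  have hσ0 : ∀ j x, 𝒢.one x ∉ tsupport β → σ j x = 0 := by
    intro j x hx
    have : V j (𝒢.one x) = 0 := by
      simp only [V, image_eq_zero_of_notMem_tsupport hx, zero_smul]
    simp only [σ, this]
    exact map_zero _
  have hσ : ∀ j, σ j ∈ 𝒢.algebroidSections := by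
    intro j
    refine ⟨fun x => ?_, fun x => ?_, ?_⟩
    · by_cases hx : 𝒢.one x ∈ tsupport β
      · refine (contMDiffAt_mfderiv_apply (f := ret) (g := 𝒢.one) (v := fun x => V j (𝒢.one x))
          (hret.contMDiffAt (hΩW x (hβΩ hx)))
          (ContMDiff.comp (hV j) 𝒢.smooth_one).contMDiffAt).congr_of_eventuallyEq ?_
        refine (hone.continuousAt.eventually (hΩ.mem_nhds (hβΩ hx))).mono fun y hy => ?_
        exact (tangentBundle_mk_congr (F := EG) (hself y hy) _).symm
      · refine ContMDiffAt.congr_of_eventuallyEq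
          (((Bundle.contMDiff_zeroSection ℝ (TangentSpace 𝓘(ℝ, EG) : G → Type _)).comp
            𝒢.smooth_one).contMDiffAt) ?_
        refine (hone.continuousAt.eventually
          ((isClosed_tsupport β).isOpen_compl.mem_nhds hx)).mono fun y hy => ?_
        simp [hσ0 j y hy, Bundle.zeroSection]
    · by_cases hx : 𝒢.one x ∈ tsupport β
      · have := hret.modelDeriv_map 𝒢.contMDiff_s (hΩW x (hβΩ hx)) (V j (𝒢.one x))
        rw [hself x (hβΩ hx)] at this
        exact this
      · rw [hσ0 j x hx]
        exact map_zero _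
    -- Since `x = s (1_x)`, the support of `σ j` lies in the compact set `s (tsupport β)`.
    · refine (β.hasCompactSupport.isCompact.image 𝒢.contMDiff_s.continuous).of_isClosed_subset
        isClosed_closure (closure_minimal (fun x hx => ⟨𝒢.one x, ?_, 𝒢.s_one x⟩)
          (β.hasCompactSupport.isCompact.image 𝒢.contMDiff_s.continuous).isClosed)
      by_contra h
      exact hx (hσ0 j x h)
  obtain ⟨O', hO'1, hO', hxO'⟩ := mem_nhds_iff.1 β.eventuallyEq_one
  -- The coefficients are the frame coordinates of `z`. Where `β = 1`, expand `v` in the frame and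
  -- apply the projection, which fixes `v` because `ds v = 0`.
  refine ⟨_, σ, fun i z => b.repr (e z).2 i, 𝒢.one ⁻¹' (Ω ∩ O'),
    (hΩ.inter hO').preimage hone, ⟨hx₀Ω, hxO'⟩, hσ, ?_, ?_, ?_⟩
  · intro i z x hx hz
    have hze : z ∈ e.source := e.mem_source.2 (by rw [hz]; exact hx.1.1)
    have h1 := ((Bundle.Trivialization.contMDiffAt_iff (n := ∞) (IB := 𝓘(ℝ, EG)) (e := e)
      (f := id) (x₀ := z) hze).1 contMDiffAt_id).2
    exact (LinearMap.toContinuousLinearMap (b.coord i)).contMDiff.contMDiffAt.comp z h1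
  · intro i x hx
    have h1 : (e ⟨𝒢.one x, 0⟩).2 = 0 := by
      have := map_zero (e.linearEquivAt ℝ (𝒢.one x) hx.1.1)
      simpa using this
    simp only [h1, map_zero, Finsupp.coe_zero, Pi.zero_apply]
  · intro x hx v hv
    have h1 : v = ∑ i, b.repr (e ⟨𝒢.one x, v⟩).2 i • V i (𝒢.one x) := by
      have h2 := ((e.basisAt b hx.1.1).sum_repr v).symm
      have hβ1 : β (𝒢.one x) = 1 := hO'1 hx.2
      simp only [V, hβ1, one_smul, e.localFrame_apply_of_mem_baseSet b hx.1.1]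
      convert h2 using 3
      simp [Bundle.Trivialization.basisAt]
    have h3 : modelDeriv EG EG (ret x) (𝒢.one x) v = v := by
      have := hret.modelDeriv_self 𝒢.contMDiff_s hx.1.2 hv
      rwa [𝒢.s_one] at this
    refine h3.symm.trans ((congrArg (modelDeriv EG EG (ret x) (𝒢.one x)) h1).trans ?_)
    refine (map_sum (modelDeriv EG EG (ret x) (𝒢.one x)) _ _).trans
      (Finset.sum_congr rfl fun i _ => ?_)
    exact map_smul (modelDeriv EG EG (ret x) (𝒢.one x)) _ (V i (𝒢.one x))

end LieGroupoid

end FoliationBisub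

namespace FoliationBisub

/-! ### Gluing by partitions of unity. -/

section Global

variable {E : Type*} [NormedAddCommGroup E] [NormedSpace ℝ E] [FiniteDimensional ℝ E]
  {F : Type*} [NormedAddCommGroup F] [NormedSpace ℝ F]
  {U : Type*} [TopologicalSpace U] [T2Space U] [SigmaCompactSpace U] [ChartedSpace E U]
  [IsManifold 𝓘(ℝ, E) ∞ U]
  {M : Type*} [TopologicalSpace M] [ChartedSpace F M] [IsManifold 𝓘(ℝ, F) ∞ M]

/-- Membership in `f^* D` is a local property of a compactly supported section. -/
theorem mem_pullbackSections_of_local {f : U → M} {D : Set (VField F M)}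
    {ξ : ∀ u : U, TangentSpace 𝓘(ℝ, F) (f u)} {K : Set U} (hK : IsCompact K)
    (hξK : ∀ u ∉ K, ξ u = 0)
    (hloc : ∀ u₀ : U, ∃ (n : ℕ) (a : Fin n → U → ℝ) (Y : Fin n → VField F M) (N : Set U),
      IsOpen N ∧ u₀ ∈ N ∧ (∀ i, ContMDiffOn 𝓘(ℝ, E) 𝓘(ℝ, ℝ) ∞ (a i) N) ∧ (∀ i, Y i ∈ D) ∧
      (∀ i, ∀ u ∈ N, u ∉ K → a i u = 0) ∧ ∀ u ∈ N, ξ u = ∑ i, a i u • Y i (f u)) :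
    ξ ∈ pullbackSections E F f D := by
  choose n a Y N hN hmem ha hY haK hsum using hloc
  obtain ⟨ρ, hρ⟩ := SmoothPartitionOfUnity.exists_isSubordinate 𝓘(ℝ, E) isClosed_univ N hN
    fun u _ => Set.mem_iUnion.2 ⟨u, hmem u⟩
  have hfin := ρ.locallyFinite.finite_nonempty_inter_compact hK
  let S := hfin.toFinset
  have hρN : ∀ i u, u ∉ N i → ρ i u = 0 := fun i u hu =>
    image_eq_zero_of_notMem_tsupport fun h => hu (hρ i h)
  let ι := Σ i : S, Fin (n i)
  let ε := Fintype.equivFin ι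
  refine ⟨Fintype.card ι, fun k u => ρ (ε.symm k).1 u • a (ε.symm k).1 (ε.symm k).2 u,
    fun k => Y (ε.symm k).1 (ε.symm k).2, fun k => ⟨?_, ?_⟩, fun k => hY _ _, fun u => ?_⟩
  · exact ρ.contMDiff_smul fun x hx => (ha _ _).contMDiffAt ((hN _).mem_nhds (hρ _ hx))
  -- The `ρ i` need not have compact support; the product does because `a` vanishes off `K`.
  · refine HasCompactSupport.intro hK fun u hu => ?_
    by_cases h : u ∈ N (ε.symm k).1
    · simp only [haK _ _ u h hu, smul_zero]
    · simp only [hρN _ u h, zero_smul]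
  · rw [ε.symm.sum_comp fun x : ι => (ρ x.1 u • a x.1 x.2 u) • Y x.1 x.2 (f u),
      Fintype.sum_sigma]
    have h1 : ∀ i : S, ∑ j, (ρ i u • a i j u) • Y i j (f u) = ρ i u • ξ u := by
      intro i
      by_cases h : u ∈ N i
      · rw [hsum _ u h, Finset.smul_sum]
        exact Finset.sum_congr rfl fun j _ => by rw [smul_eq_mul, mul_smul]
      · simp only [hρN _ u h, zero_smul, Finset.sum_const_zero]
    rw [Finset.sum_congr rfl fun i _ => h1 i, ← Finset.sum_smul]
    by_cases hu : u ∈ K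
    · have h2 : ∑ i : S, ρ i u = 1 := by
        rw [Finset.sum_coe_sort S fun i => ρ i u, ← ρ.sum_eq_one (Set.mem_univ u)]
        refine (finsum_eq_sum_of_support_subset _ fun i hi => ?_).symm
        exact hfin.mem_toFinset.2 ⟨u, hi, hu⟩
      rw [h2, one_smul]
    · rw [hξK u hu, smul_zero]

/-- Smooth vector fields lift along submersions. -/
theorem exists_related_of_isSubmersion {f : U → M}
    (hf : Manifold.IsSubmersion 𝓘(ℝ, E) 𝓘(ℝ, F) ∞ f) {Y : VField F M}
    (hY : Y ∈ smoothFields F M) : ∃ Z ∈ smoothFields E U, Related E F f Z Y := by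
  obtain ⟨Z, hZ⟩ := exists_contMDiffSection_forall_mem_convex_of_local (n := ⊤) 𝓘(ℝ, E)
    (TangentSpace 𝓘(ℝ, E) : U → Type _) (fun u => {z | modelDeriv E F f u z = Y (f u)})
    (fun u z hz w hw p q _ _ hpq => by
      have h1 : modelDeriv E F f u (p • z + q • w) =
          p • modelDeriv E F f u z + q • modelDeriv E F f u w :=
        ((modelDeriv E F f u).map_add _ _).trans
          (congrArg₂ _ ((modelDeriv E F f u).map_smul _ _) ((modelDeriv E F f u).map_smul _ _))
      have h2 : modelDeriv E F f u z = Y (f u) := hz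
      have h3 : modelDeriv E F f u w = Y (f u) := hw
      have h4 : p • (Y (f u) : F) + q • (Y (f u) : F) = Y (f u) := by
        rw [← add_smul, hpq, one_smul]
      rw [h2, h3] at h1
      exact h1.trans h4)
    (fun u₀ => by
      obtain ⟨ret, W, hret, hW⟩ := exists_fiberRetraction (hf.isSubmersionAt u₀)
      have hc : Continuous fun u => (f u, u) := hf.contMDiff.continuous.prodMk continuous_id
      refine ⟨(fun u => (f u, u)) ⁻¹' W, (hret.isOpen.preimage hc).mem_nhds hW,
        -- The local lift pushes `Y` forward along the local section `y ↦ ret y u`.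
        fun u => modelDeriv F E (fun y => ret y u) (f u) (Y (f u)), fun u hu => ?_, fun u hu =>
        hret.modelDeriv_lift hf.contMDiff hu _⟩
      have h1 : ContMDiffAt (𝓘(ℝ, E).prod 𝓘(ℝ, F)) 𝓘(ℝ, E) ∞
          (Function.uncurry fun u y => ret y u) (u, f u) :=
        ContMDiffAt.comp (g := Function.uncurry ret) (f := fun q : U × M => (q.2, q.1)) (u, f u)
          (hret.contMDiffAt hu) (contMDiffAt_snd.prodMk contMDiffAt_fst)
      refine ((contMDiffAt_mfderiv_apply (v := fun u => Y (f u)) h1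
        (ContMDiff.comp hY hf.contMDiff).contMDiffAt).congr_of_eventuallyEq
          ?_).contMDiffWithinAt
      refine (hc.continuousAt.eventually (hret.isOpen.mem_nhds hu)).mono fun y hy => ?_
      exact (tangentBundle_mk_congr (F := E) (hret.ret_self y hy) _).symm)
  exact ⟨Z, Z.contMDiff, hZ⟩

end Global

/-! ### Expansion of vertical fields in invariant fields. -/

namespace LieGroupoid

variable {EG : Type*} [NormedAddCommGroup EG] [NormedSpace ℝ EG] [FiniteDimensional ℝ EG]
  {EM : Type*} [NormedAddCommGroup EM] [NormedSpace ℝ EM]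
  {EU : Type*} [NormedAddCommGroup EU] [NormedSpace ℝ EU] [FiniteDimensional ℝ EU]
  {G : Type*} [TopologicalSpace G] [T2Space G] [ChartedSpace EG G] [IsManifold 𝓘(ℝ, EG) ∞ G]
  {M : Type*} [TopologicalSpace M] [T2Space M] [ChartedSpace EM M] [IsManifold 𝓘(ℝ, EM) ∞ M]
  {U : Type*} [TopologicalSpace U] [T2Space U] [ChartedSpace EU U] [IsManifold 𝓘(ℝ, EU) ∞ U]
  (𝒢 : LieGroupoid EG EM G M)

theorem exists_local_expansion {ψ : U → G} (hψ : ContMDiff 𝓘(ℝ, EU) 𝓘(ℝ, EG) ∞ ψ)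
    {X : VField EU U} (hX : X ∈ smoothFields EU U)
    (hker : ∀ u, modelDeriv EG EM 𝒢.s (ψ u) (modelDeriv EU EG ψ u (X u)) = 0) (u₀ : U) :
    ∃ (n : ℕ) (a : Fin n → U → ℝ) (Y : Fin n → VField EG G) (N : Set U),
      IsOpen N ∧ u₀ ∈ N ∧ (∀ i, ContMDiffOn 𝓘(ℝ, EU) 𝓘(ℝ, ℝ) ∞ (a i) N) ∧
      (∀ i, Y i ∈ 𝒢.rightModule) ∧ (∀ i, ∀ u ∈ N, X u = 0 → a i u = 0) ∧
      ∀ u ∈ N, modelDeriv EU EG ψ u (X u) = ∑ i, a i u • (Y i (ψ u) : EG) := by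
  obtain ⟨n, σ, c, O, hO, hu₀O, hσ, hc, hc0, hsum⟩ := 𝒢.exists_local_generators (𝒢.t (ψ u₀))
  obtain ⟨β⟩ : Nonempty (SmoothBumpFunction 𝓘(ℝ, EG) (ψ u₀)) := inferInstance
  obtain ⟨O', hO'1, hO', hu₀O'⟩ := mem_nhds_iff.1 β.eventuallyEq_one
  -- The translate of `dψ (X u)` to the unit at `t (ψ u)`; its coordinates are the coefficients
  -- sought.
  let η : U → EG := fun u => 𝒢.rightDeriv (𝒢.inv (ψ u)) (ψ u) (modelDeriv EU EG ψ u (X u))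
  have hcomp : ∀ u, 𝒢.s (ψ u) = 𝒢.t (𝒢.inv (ψ u)) := fun u => (𝒢.t_inv _).symm
  have hη : ContMDiff 𝓘(ℝ, EU) 𝓘(ℝ, EG).tangent ∞
      (fun u => (⟨𝒢.one (𝒢.t (ψ u)), η u⟩ : TangentBundle 𝓘(ℝ, EG) G)) := by
    intro u
    have h1 := contMDiffAt_rightDeriv (𝒢 := 𝒢) (p₀ := u) (g := fun u => 𝒢.inv (ψ u)) (h := ψ)
      (ξ := fun u => modelDeriv EU EG ψ u (X u)) (𝒢.smooth_inv.comp hψ).contMDiffAt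
      ((hψ.contMDiff_tangentMap (m := ∞) le_rfl).comp hX).contMDiffAt hcomp hker
    convert h1 using 1
    funext u
    exact (tangentBundle_mk_congr (F := EG) (𝒢.mul_inv _) _).symm
  have hηker : ∀ u, modelDeriv EG EM 𝒢.s (𝒢.one (𝒢.t (ψ u))) (η u) = 0 := fun u => by
    have := modelDeriv_s_rightDeriv (hcomp u) (hker u)
    rwa [𝒢.mul_inv] at this
  have htψ : Continuous fun u => 𝒢.t (ψ u) := 𝒢.contMDiff_t.continuous.comp hψ.continuous
  -- Elements of `rightModule` need compactly supported coefficients, hence the factor `β`, which is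
  -- `1` on the neighbourhood used.
  refine ⟨n, fun i u => c i ⟨𝒢.one (𝒢.t (ψ u)), η u⟩, fun i g => β g • 𝒢.rightField (σ i) g,
    (fun u => 𝒢.t (ψ u)) ⁻¹' O ∩ ψ ⁻¹' O',
    (hO.preimage htψ).inter (hO'.preimage hψ.continuous), ⟨hu₀O, hu₀O'⟩, ?_, ?_, ?_, ?_⟩
  · intro i u hu
    exact (ContMDiffAt.comp u (hc i _ _ hu.1 rfl) hη.contMDiffAt).contMDiffWithinAt
  · intro i
    exact ⟨1, fun _ => β, fun _ => σ i, fun _ => ⟨β.contMDiff, β.hasCompactSupport⟩,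
      fun _ => hσ i, fun g => by simp⟩
  · intro i u hu hXu
    have : η u = 0 := by
      simp only [η, hXu]
      exact (congrArg _ (map_zero (modelDeriv EU EG ψ u))).trans (map_zero _)
    simp only [this]
    exact hc0 i _ hu.1
  · intro u hu
    have h1 := rightDeriv_rightDeriv_inv (hker u)
    have h2 := congrArg (𝒢.rightDeriv (ψ u) (𝒢.one (𝒢.t (ψ u)))) (hsum _ hu.1 (η u) (hηker u))
    refine h1.symm.trans (h2.trans ?_)
    have hβ : β (ψ u) = 1 := hO'1 hu.2
    refine (map_sum (𝒢.rightDeriv (ψ u) (𝒢.one (𝒢.t (ψ u)))) _ _).trans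
      (Finset.sum_congr rfl fun i _ => ?_)
    simp only [hβ, rightField_eq]
    exact (map_smul (𝒢.rightDeriv (ψ u) (𝒢.one (𝒢.t (ψ u)))) _ (σ i (𝒢.t (ψ u)))).trans
      (congrArg _ (one_smul ℝ _).symm)

theorem pullbackFields_rightModule [SigmaCompactSpace U] {ψ : U → G}
    (hψ : ContMDiff 𝓘(ℝ, EU) 𝓘(ℝ, EG) ∞ ψ) :
    pullbackFields EU EG ψ 𝒢.rightModule = verticalFields EU EM (𝒢.s ∘ ψ) := by
  have hchain : ∀ u (v : EU), modelDeriv EU EM (𝒢.s ∘ ψ) u v =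
      modelDeriv EG EM 𝒢.s (ψ u) (modelDeriv EU EG ψ u v) := fun u v =>
    modelDeriv_comp (𝒢.contMDiff_s.mdifferentiableAt (by simp)) (hψ.mdifferentiableAt (by simp)) v
  ext X
  constructor
  · rintro ⟨hX, k, g, Y, -, hY, hsum⟩
    refine ⟨hX, fun u => (hchain u (X u)).trans ?_⟩
    have hYker : ∀ i, modelDeriv EG EM 𝒢.s (ψ u) (Y i (ψ u)) = 0 := by
      intro i
      obtain ⟨l, f, σ, -, hσ, hYi⟩ := hY i
      rw [hYi]
      refine (map_sum (modelDeriv EG EM 𝒢.s (ψ u)) _ _).trans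
        (Finset.sum_eq_zero fun j _ => ?_)
      refine (map_smul (modelDeriv EG EM 𝒢.s (ψ u)) _ (𝒢.rightField (σ j) (ψ u))).trans ?_
      exact (congrArg (f j (ψ u) • ·) (modelDeriv_s_rightField (hσ j) (ψ u))).trans (smul_zero _)
    refine (congrArg (modelDeriv EG EM 𝒢.s (ψ u)) (hsum u)).trans
      ((map_sum (modelDeriv EG EM 𝒢.s (ψ u)) _ _).trans (Finset.sum_eq_zero fun i _ => ?_))
    refine (map_smul (modelDeriv EG EM 𝒢.s (ψ u)) _ (Y i (ψ u))).trans ?_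
    exact (congrArg (g i u • ·) (hYker i)).trans (smul_zero _)
  · rintro ⟨hX, hker⟩
    have hX0 : ∀ u ∉ closure {u | X u ≠ 0}, X u = 0 := fun u hu => by
      by_contra h
      exact hu (subset_closure h)
    refine ⟨hX, mem_pullbackSections_of_local hX.2 (fun u hu => ?_) fun u₀ => ?_⟩
    · rw [hX0 u hu]
      exact map_zero (modelDeriv EU EG ψ u)
    · obtain ⟨n, a, Y, N, hN, hu₀, ha, hY, ha0, hsum⟩ := 𝒢.exists_local_expansion hψ hX.1
        (fun u => (hchain u (X u)).symm.trans (hker u)) u₀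
      exact ⟨n, a, Y, N, hN, hu₀, ha, hY, fun i u hu hK => ha0 i u hu (hX0 u hK), hsum⟩

/-! ### Inversion and the left-invariant case. -/

/-- The differential of the inversion carries sections of the Lie algebroid to sections of the
Lie algebroid of the opposite groupoid. -/
noncomputable def invSection (σ : ∀ x : M, TangentSpace 𝓘(ℝ, EG) (𝒢.one x)) :
    ∀ x : M, TangentSpace 𝓘(ℝ, EG) (𝒢.opposite.one x) :=
  fun x => mfderiv 𝓘(ℝ, EG) 𝓘(ℝ, EG) 𝒢.inv (𝒢.one x) (σ x)

variable {𝒢} in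
theorem invSection_mem {σ : ∀ x : M, TangentSpace 𝓘(ℝ, EG) (𝒢.one x)}
    (hσ : σ ∈ 𝒢.algebroidSections) : 𝒢.invSection σ ∈ 𝒢.opposite.algebroidSections := by
  refine ⟨?_, fun x => ?_, ?_⟩
  · have h1 := (𝒢.smooth_inv.contMDiff_tangentMap (m := ∞) le_rfl).comp hσ.1
    convert h1 using 1
    funext x
    exact (tangentBundle_mk_congr (F := EG) (𝒢.inv_one x) _).symm
  · have h1 := modelDeriv_comp (g := 𝒢.t) (f := 𝒢.inv) (u := 𝒢.one x)
      (𝒢.contMDiff_t.mdifferentiableAt (by simp)) (𝒢.smooth_inv.mdifferentiableAt (by simp)) (σ x)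
    have h2 : 𝒢.t ∘ 𝒢.inv = 𝒢.s := funext 𝒢.t_inv
    rw [h2, 𝒢.inv_one] at h1
    exact h1.symm.trans (hσ.2.1 x)
  · refine hσ.2.2.of_isClosed_subset isClosed_closure (closure_mono fun x hx h => hx ?_)
    simp only [invSection, h]
    exact map_zero _

theorem invSection_invSection (σ : ∀ x : M, TangentSpace 𝓘(ℝ, EG) (𝒢.one x)) :
    𝒢.opposite.invSection (𝒢.invSection σ) = σ := by
  funext x
  have hinv := 𝒢.smooth_inv.mdifferentiable (by simp)
  have h1 := modelDeriv_comp (g := 𝒢.inv) (f := 𝒢.inv) (u := 𝒢.one x) (hinv _) (hinv _) (σ x)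
  have h2 : 𝒢.inv ∘ 𝒢.inv = fun g => g := funext 𝒢.inv_inv
  rw [h2, 𝒢.inv_one] at h1
  exact h1.symm.trans (modelDeriv_id _ _)

/-- By definition, the left field of `σ` is the right field of `invSection σ` in the opposite
groupoid, and `invSection` is an involution. -/
theorem leftModule_eq : 𝒢.leftModule = 𝒢.opposite.rightModule := by
  ext Y
  constructor
  · rintro ⟨k, f, σ, hf, hσ, hY⟩
    exact ⟨k, f, fun i => 𝒢.invSection (σ i), hf, fun i => invSection_mem (hσ i), hY⟩
  · rintro ⟨k, f, σ, hf, hσ, hY⟩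
    refine ⟨k, f, fun i => 𝒢.opposite.invSection (σ i), hf,
      fun i => invSection_mem (𝒢 := 𝒢.opposite) (hσ i), fun g => (hY g).trans ?_⟩
    refine Finset.sum_congr rfl fun i _ => ?_
    exact congrArg (fun τ => f i g • 𝒢.opposite.rightField τ g)
      (𝒢.opposite.invSection_invSection (σ i)).symm

end LieGroupoid

end FoliationBisub

theorem mainTheorem7
    {EG : Type*} [NormedAddCommGroup EG] [NormedSpace ℝ EG] [FiniteDimensional ℝ EG]
    {EM : Type*} [NormedAddCommGroup EM] [NormedSpace ℝ EM] [FiniteDimensional ℝ EM]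
    {EU : Type*} [NormedAddCommGroup EU] [NormedSpace ℝ EU] [FiniteDimensional ℝ EU]
    {G : Type*} [TopologicalSpace G] [T2Space G] [ChartedSpace EG G]
    [IsManifold 𝓘(ℝ, EG) ∞ G]
    {M : Type*} [TopologicalSpace M] [T2Space M] [ChartedSpace EM M]
    [IsManifold 𝓘(ℝ, EM) ∞ M]
    {U : Type*} [TopologicalSpace U] [T2Space U] [SecondCountableTopology U]
    [ChartedSpace EU U] [IsManifold 𝓘(ℝ, EU) ∞ U]
    (𝒢 : FoliationBisub.LieGroupoid EG EM G M)
    (tU sU : U → M)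
    (hU : FoliationBisub.IsBisubmersion EU EM 𝒢.orbitFoliation tU sU)
    (ψ : U → G) (hψ : Manifold.IsSubmersion 𝓘(ℝ, EU) 𝓘(ℝ, EG) ∞ ψ)
    (hs : sU = 𝒢.s ∘ ψ) (ht : tU = 𝒢.t ∘ ψ) :
    𝒢.IsAlgebroidBisubmersion EU ψ := by
  -- With second countability this makes `U` σ-compact, as partitions of unity require.
  have := ChartedSpace.locallyCompactSpace EU U
  subst hs ht
  refine ⟨hψ.contMDiff, hU.submersion_s, hU.submersion_t, fun σ hσ => ?_, fun σ hσ => ?_,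
    𝒢.pullbackFields_rightModule hψ.contMDiff, ?_⟩
  · exact FoliationBisub.exists_related_of_isSubmersion hψ
      (FoliationBisub.LieGroupoid.contMDiff_rightField hσ)
  · exact FoliationBisub.exists_related_of_isSubmersion hψ
      (FoliationBisub.LieGroupoid.contMDiff_rightField (𝒢 := 𝒢.opposite)
        (FoliationBisub.LieGroupoid.invSection_mem hσ))
  · rw [𝒢.leftModule_eq]
    exact 𝒢.opposite.pullbackFields_rightModule hψ.contMDiff
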